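/- Let $N=2n+1$ be odd, let $V\cong\mathbb{C}^N$ be a complex vector space with a non-degenerate symmetric bilinear form $(-,-)$, fix $m<N/2$, and let $\mathrm{OG}=\mathrm{OG}(m,N)$ be the orthogonal Grassmannian of $m$-dimensional isotropic subspaces of $V$, with its Zariski topology. Fix an isotropic flag $0=F_0\subsetneq F_1\subsetneq\dots\subsetneq F_N=V$ (that is, $F_i=F_j^\perp$ whenever $i+j=N$), let $B\subset\mathrm{SO}(V)$ be the Borel subgroup stabilizing it, and fix a basis $e_1,\dots,e_N$ of $V$ with $(e_i,e_j)=\delta_{i+j,N+1}$ and $F_p=\langle e_1,\dots,e_p\rangle$ for each $p$. An \emph{index set} is a subset $P=\{p_1<\dots<p_m\}\subset[1,N]$ of cardinality $m$ such that $i+j\neq N+1$ for all $i,j\in P$ (including $i=j$). For an index set $P$ let $X_P^\circ=B\cdot\langle e_p : p\in P\rangle\subset\mathrm{OG}$, and let the Schubert variety $X_P=\overline{X_P^\circ}$ be its Zariski closure in $\mathrm{OG}$. For index sets $P=\{p_1<\dots<p_m\}$ and $Q=\{q_1<\dots<q_m\}$ write $Q\leq P$ if $q_j\leq p_j$ for each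 $j$. Then for any index set $P=\{p_1<\dots<p_m\}$ we have \[ X_P=Y_P:=\{\Sigma\in\mathrm{OG}\mid \dim(\Sigma\cap F_{p_j})\geq j\ \text{ for all } 1\leq j\leq m\}. \] Moreover, for any two index sets $P$ and $Q$, we have $X_Q\subset X_P$ if and only if $Q\leq P$. -/

import Mathlib

open Module

namespace OrthogonalGrassmannian

variable {V : Type*} [AddCommGroup V] [Module ℂ V]

/-- The orthogonal Grassmannian `OG(m, V)` of `m`-dimensional isotropic subspaces of `V`. -/
def OG (B : LinearMap.BilinForm ℂ V) (m : ℕ) : Type _ :=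
  {S : Submodule ℂ V // finrank ℂ S = m ∧ ∀ x ∈ S, ∀ y ∈ S, B x y = 0}

/-- The Plücker coordinates of an `m`-tuple of vectors `v`. The coordinate labelled by the linear
forms `φ₁, …, φₘ` is the value of `φ₁ ∧ ⋯ ∧ φₘ` on `v₁ ∧ ⋯ ∧ vₘ`, i.e. `det (φ_a (v_b))`. -/
noncomputable def pluecker {m : ℕ} (v : Fin m → V) (φ : Fin m → Dual ℂ V) : ℂ :=
  Matrix.det (Matrix.of fun a b => φ a (v b))

/-- The locus in `OG(m, V)` where a polynomial `f` in the Plücker coordinates does not vanish.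
For homogeneous `f` the condition does not depend on the basis `v` of the subspace. -/
def nonvanishing (B : LinearMap.BilinForm ℂ V) (m : ℕ)
    (f : MvPolynomial (Fin m → Dual ℂ V) ℂ) : Set (OG B m) :=
  {S | ∃ v : Basis (Fin m) ℂ S.1, MvPolynomial.eval (pluecker fun b => (v b : V)) f ≠ 0}

/-- The Zariski topology on `OG(m, V)`, as a subvariety of the projective space of `⋀ᵐ V` by the
Plücker embedding: it is generated by the nonvanishing loci of homogeneous polynomials. -/
instance zariskiTopology (B : LinearMap.BilinForm ℂ V) (m : ℕ) : TopologicalSpace (OG B m) :=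
  TopologicalSpace.generateFrom
    {U | ∃ (d : ℕ) (f : MvPolynomial (Fin m → Dual ℂ V) ℂ),
      f.IsHomogeneous d ∧ U = nonvanishing B m f}

/-- An isotropic flag `0 = F₀ ⊊ F₁ ⊊ ⋯ ⊊ F_N = V`, with `F_i = F_j^⊥` whenever `i + j = N`. -/
structure IsIsotropicFlag (B : LinearMap.BilinForm ℂ V) {N : ℕ}
    (F : Fin (N + 1) → Submodule ℂ V) : Prop where
  zero : F 0 = ⊥
  last : F (Fin.last N) = ⊤
  strictMono : StrictMono F
  orthogonal : ∀ i j : Fin (N + 1), (i : ℕ) + j = N → F i = B.orthogonal (F j)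

/-- A basis `e₁, …, e_N` with `(e_i, e_j) = δ_{i+j, N+1}` and `F_p = ⟨e₁, …, e_p⟩` for each `p`.
The vector `e_i` is `e ⟨i - 1, _⟩` here. -/
structure IsAdaptedBasis (B : LinearMap.BilinForm ℂ V) {N : ℕ}
    (F : Fin (N + 1) → Submodule ℂ V) (e : Basis (Fin N) ℂ V) : Prop where
  form : ∀ i j : Fin N, B (e i) (e j) = if ((i : ℕ) + 1) + ((j : ℕ) + 1) = N + 1 then 1 else 0
  flag : ∀ p : Fin (N + 1), F p = Submodule.span ℂ (e '' {i | (i : ℕ) + 1 ≤ p})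

/-- `SO(V)`: the linear automorphisms of determinant one that preserve the form. -/
def specialOrthogonal (B : LinearMap.BilinForm ℂ V) : Subgroup (V ≃ₗ[ℂ] V) where
  carrier := {g | (∀ x y, B (g x) (g y) = B x y) ∧ LinearEquiv.det g = 1}
  one_mem' := ⟨fun _ _ => rfl, map_one _⟩
  mul_mem' := by
    rintro g h ⟨hg, hg'⟩ ⟨hh, hh'⟩
    refine ⟨fun x y => ?_, by rw [map_mul, hg', hh', one_mul]⟩
    rw [LinearEquiv.mul_apply, LinearEquiv.mul_apply, hg, hh]
  inv_mem' := by
    rintro g ⟨hg, hg'⟩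
    refine ⟨fun x y => ?_, by rw [map_inv, hg', inv_one]⟩
    rw [← hg, ← LinearEquiv.mul_apply, ← LinearEquiv.mul_apply, mul_inv_cancel]
    rfl

/-- The elements of the Borel subgroup of `SO(V)` stabilizing the flag `F`. -/
def borel (B : LinearMap.BilinForm ℂ V) {N : ℕ} (F : Fin (N + 1) → Submodule ℂ V) :
    Set (V ≃ₗ[ℂ] V) :=
  {g | g ∈ specialOrthogonal B ∧ ∀ i, (F i).map (g : V →ₗ[ℂ] V) = F i}

/-- Index sets: `m`-element subsets `P` of `{1, …, N}` with `i + j ≠ N + 1` for all `i, j ∈ P`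
(including `i = j`). The integer `i` is represented by `⟨i - 1, _⟩ : Fin N`. -/
structure IndexSet (N m : ℕ) where
  carrier : Finset (Fin N)
  card_eq : carrier.card = m
  add_ne : ∀ i ∈ carrier, ∀ j ∈ carrier, ((i : ℕ) + 1) + ((j : ℕ) + 1) ≠ N + 1

namespace IndexSet

variable {N m : ℕ}

/-- The increasing enumeration `p₁ < ⋯ < pₘ` of an index set; `p_{j+1}` is `P.elem j`, with its
representation in `Fin N` shifted by one as above. -/
def elem (P : IndexSet N m) : Fin m ↪o Fin N := P.carrier.orderEmbOfFin P.card_eq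

/-- `Q ≤ P` if `q_j ≤ p_j` for each `j`. -/
instance : LE (IndexSet N m) := ⟨fun Q P => ∀ j, Q.elem j ≤ P.elem j⟩

end IndexSet

/-- The Schubert cell: the orbit of `⟨e_p : p ∈ P⟩` under the Borel subgroup stabilizing `F`. -/
def schubertCell (B : LinearMap.BilinForm ℂ V) {N m : ℕ} (F : Fin (N + 1) → Submodule ℂ V)
    (e : Basis (Fin N) ℂ V) (P : IndexSet N m) : Set (OG B m) :=
  {S | ∃ g ∈ borel B F, S.1 = (Submodule.span ℂ (e '' P.carrier)).map (g : V →ₗ[ℂ] V)}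

/-- The Schubert variety `X_P`: the Zariski closure of the Schubert cell. -/
def schubertVariety (B : LinearMap.BilinForm ℂ V) {N m : ℕ} (F : Fin (N + 1) → Submodule ℂ V)
    (e : Basis (Fin N) ℂ V) (P : IndexSet N m) : Set (OG B m) :=
  closure (schubertCell B F e P)

/-- `Y_P = {Σ | dim (Σ ∩ F_{p_j}) ≥ j for 1 ≤ j ≤ m}`. Both the index `j` and the number `p_j` are
shifted by one, so `F_{p_j}` is `F (P.elem j).succ`. -/
def rankLocus (B : LinearMap.BilinForm ℂ V) {N m : ℕ} (F : Fin (N + 1) → Submodule ℂ V)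
    (P : IndexSet N m) : Set (OG B m) :=
  {S | ∀ j : Fin m, (j : ℕ) + 1 ≤ finrank ℂ (S.1 ⊓ F (P.elem j).succ : Submodule ℂ V)}

end OrthogonalGrassmannian

/-!
The leading index of a vector is the position of its last nonzero coordinate in the adapted basis,
and the leading indices of an isotropic subspace form an index set. Moving leading vectors to basis
vectors by Eichler transformations shows that a Schubert cell consists of all isotropic subspaces
with a given index set, and counting the leading indices below `p` computes `dim (Σ ∩ F_p)`. Hence
the rank locus `Y_P` is the union of the cells of all `Q ≤ P`; it is closed, since
`dim (Σ ∩ W) ≥ d` is a closed condition.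

It remains to see that the cell of `Q` lies in `X_P` whenever `Q ≤ P`. One descends from `P` to `Q`
by lowering one element, or a pair of elements made mirror images of each other's old values, and
each such step is realized by a curve of isotropic subspaces: a pencil `e_{p'} + s e_p`, a pair of
pencils with opposite signs, or the conic `e_{p'} + s e_μ - (s² / 2) e_p` through the middle vector
`e_μ` when `p'` is the mirror image of `p`.
-/

namespace OrthogonalGrassmannian

section LeadingIndices

variable {K V : Type*} [Field K] [AddCommGroup V] [Module K V] {N : ℕ} (e : Basis (Fin N) K V)

variable {e} in
lemma mem_flag_iff {k : Fin (N + 1)} {x : V} :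
    x ∈ e.flag k ↔ ∀ i : Fin N, k ≤ i.castSucc → e.repr x i = 0 := by
  rw [Basis.flag, Basis.mem_span_image]
  refine forall_congr' fun i => ?_
  rw [SetLike.mem_coe, Finsupp.mem_support_iff, not_imp_comm, Set.mem_ofPred_eq, not_lt]

lemma mem_flag_castSucc_iff {i : Fin N} {x : V} :
    x ∈ e.flag i.castSucc ↔ x ∈ e.flag i.succ ∧ e.repr x i = 0 := by
  refine ⟨fun hx => ⟨e.flag_mono i.castSucc_le_succ hx, mem_flag_iff.1 hx i le_rfl⟩, ?_⟩
  rintro ⟨hx, hi⟩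
  refine mem_flag_iff.2 fun j hij => ?_
  obtain rfl | hlt := (Fin.castSucc_le_castSucc_iff.1 hij).eq_or_lt
  · exact hi
  · exact mem_flag_iff.1 hx j (Fin.succ_le_castSucc_iff.2 hlt)

/-- The last nonzero coordinate of `x` in the basis `e` is the one with index `i`. -/
def HasLeadingIndex (x : V) (i : Fin N) : Prop :=
  x ∈ e.flag i.succ ∧ e.repr x i ≠ 0

lemma hasLeadingIndex_self (i : Fin N) : HasLeadingIndex e (e i) i :=
  ⟨e.self_mem_flag i.castSucc_lt_succ, by simp⟩

variable {e} in
lemma hasLeadingIndex_iff_notMem {x : V} {i : Fin N} :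
    HasLeadingIndex e x i ↔ x ∈ e.flag i.succ ∧ x ∉ e.flag i.castSucc := by
  rw [HasLeadingIndex, mem_flag_castSucc_iff]
  tauto

open Classical in
/-- The set of leading indices of the vectors of a subspace `S`. These are the pivots of `S`,
i.e. the positions at which the dimension of its intersection with the flag of `e` jumps. -/
noncomputable def leadingIndices (S : Submodule K V) : Finset (Fin N) :=
  {i | ∃ x ∈ S, HasLeadingIndex e x i}

variable {e} in
lemma mem_leadingIndices {S : Submodule K V} {i : Fin N} :
    i ∈ leadingIndices e S ↔ ∃ x ∈ S, HasLeadingIndex e x i := by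
  simp [leadingIndices]

lemma finrank_inf_flag_succ (S : Submodule K V) (i : Fin N) :
    finrank K (S ⊓ e.flag i.succ : Submodule K V) =
      (if i ∈ leadingIndices e S then 1 else 0) +
        finrank K (S ⊓ e.flag i.castSucc : Submodule K V) := by
  have := e.finiteDimensional_of_finite
  let φ := (e.coord i).domRestrict (S ⊓ e.flag i.succ)
  have hker : (LinearMap.ker φ).map (Submodule.subtype _) = S ⊓ e.flag i.castSucc := by
    ext x
    simp [φ, mem_flag_castSucc_iff, and_comm, and_assoc]
  rw [← φ.finrank_range_add_finrank_ker, ← hker, Submodule.finrank_map_subtype_eq]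
  congr 1
  split_ifs with hi
  · obtain ⟨x, hxS, hx, hxi⟩ := mem_leadingIndices.1 hi
    have hφ : φ ≠ 0 := fun h => hxi (LinearMap.congr_fun h ⟨x, hxS, hx⟩)
    rw [LinearMap.range_eq_top.2 (LinearMap.surjective_of_ne_zero hφ), finrank_top, finrank_self]
  · have hφ : φ = 0 := by
      ext ⟨x, hxS, hx⟩
      exact not_not.1 fun hxi => hi (mem_leadingIndices.2 ⟨x, hxS, hx, hxi⟩)
    rw [hφ, LinearMap.range_zero, finrank_bot]

lemma finrank_inf_flag (S : Submodule K V) (k : Fin (N + 1)) :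
    finrank K (S ⊓ e.flag k : Submodule K V) =
      (leadingIndices e S |>.filter fun i => i.castSucc < k).card := by
  induction k using Fin.induction with
  | zero => rw [Basis.flag_zero, inf_bot_eq, finrank_bot]; simp
  | succ i ih =>
    simp only [Fin.castSucc_lt_castSucc_iff] at ih
    simp only [finrank_inf_flag_succ, ih, Fin.castSucc_lt_succ_iff, Finset.card_filter,
      le_iff_eq_or_lt]
    rw [← Finset.sum_ite_eq' (leadingIndices e S) i fun _ => 1, ← Finset.sum_add_distrib]
    refine Finset.sum_congr rfl fun j _ => ?_
    by_cases hj : j = i <;> simp [hj]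

lemma finrank_eq_card_leadingIndices (S : Submodule K V) :
    finrank K S = (leadingIndices e S).card := by
  have h := finrank_inf_flag e S (Fin.last N)
  rw [Basis.flag_last, inf_top_eq] at h
  simpa [Fin.castSucc_lt_last] using h

section Families

variable {e} {ι : Type*} {v : ι → V} {i : ι ↪ Fin N}

lemma map_subset_leadingIndices_span [Fintype ι] (hv : ∀ a, HasLeadingIndex e (v a) (i a)) :
    Finset.univ.map i ⊆ leadingIndices e (Submodule.span K (Set.range v)) := by
  intro _ hi
  obtain ⟨a, -, rfl⟩ := Finset.mem_map.1 hi
  exact mem_leadingIndices.2 ⟨v a, Submodule.subset_span ⟨a, rfl⟩, hv a⟩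

lemma linearIndependent_of_hasLeadingIndex (hv : ∀ a, HasLeadingIndex e (v a) (i a)) :
    LinearIndependent K v := by
  have := Fintype.ofInjective i i.injective
  rw [linearIndependent_iff_card_le_finrank_span, Set.finrank, finrank_eq_card_leadingIndices e]
  simpa using Finset.card_le_card (map_subset_leadingIndices_span hv)

lemma leadingIndices_span [Fintype ι] (hv : ∀ a, HasLeadingIndex e (v a) (i a)) :
    leadingIndices e (Submodule.span K (Set.range v)) = Finset.univ.map i := by
  refine (Finset.eq_of_subset_of_card_le (map_subset_leadingIndices_span hv) ?_).symm
  rw [← finrank_eq_card_leadingIndices, Finset.card_map, Finset.card_univ]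
  exact finrank_range_le_card v

end Families

end LeadingIndices

section Eichler

variable {K V : Type*} [Field K] [AddCommGroup V] [Module K V] {B : LinearMap.BilinForm K V}

/-- The Eichler transformation `x ↦ x + (x, f) a - (x, a) f - (a, a) / 2 (x, f) f`. It is an
isometry of a symmetric form when `f` is isotropic and orthogonal to `a`. -/
noncomputable def eichler (B : LinearMap.BilinForm K V) (f a : V) : V →ₗ[K] V :=
  LinearMap.id + (B.flip f).smulRight a - (B.flip a).smulRight f
    - (B a a / 2) • (B.flip f).smulRight f

lemma eichler_apply (f a x : V) :
    eichler B f a x = x + B x f • a - B x a • f - (B a a / 2) • B x f • f := by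
  simp [eichler]

variable [NeZero (2 : K)] {f a : V}

lemma apply_eichler_eichler (hB : B.IsSymm) (hf : B f f = 0) (haf : B a f = 0) (x y : V) :
    B (eichler B f a x) (eichler B f a y) = B x y := by
  have hfa : B f a = 0 := by rw [hB.eq, haf]
  simp only [eichler_apply, map_add, map_sub, map_smul, LinearMap.add_apply, LinearMap.sub_apply,
    LinearMap.smul_apply, smul_eq_mul, hf, haf, hfa, hB.eq f y, hB.eq a y]
  field_simp
  ring

lemma eichler_neg_eichler (hB : B.IsSymm) (hf : B f f = 0) (haf : B a f = 0) (x : V) :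
    eichler B f (-a) (eichler B f a x) = x := by
  have hfa : B f a = 0 := by rw [hB.eq, haf]
  simp only [eichler_apply, map_add, map_sub, map_smul, map_neg, LinearMap.neg_apply, hf, haf, hfa]
  match_scalars <;> field_simp <;> ring

/-- The Eichler transformation as a linear automorphism; its inverse replaces `a` by `-a`. -/
noncomputable def eichlerEquiv (hB : B.IsSymm) (hf : B f f = 0) (haf : B a f = 0) : V ≃ₗ[K] V :=
  LinearEquiv.ofLinearMap (eichler B f a) (eichler B f (-a))
    (LinearMap.ext fun x => by
      simpa using eichler_neg_eichler (a := -a) hB hf (by simp [haf]) x)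
    (LinearMap.ext fun x => by simpa using eichler_neg_eichler hB hf haf x)

end Eichler

section AdaptedBasis

variable {V : Type*} [AddCommGroup V] [Module ℂ V] {N : ℕ} {B : LinearMap.BilinForm ℂ V}
  {F : Fin (N + 1) → Submodule ℂ V} {e : Basis (Fin N) ℂ V}

namespace IsAdaptedBasis

lemma flag_eq (he : IsAdaptedBasis B F e) : F = e.flag := by
  ext1 k
  simp only [he.flag, Basis.flag, Fin.lt_def, Fin.val_castSucc, Nat.succ_le_iff]

lemma apply_self (he : IsAdaptedBasis B F e) (i j : Fin N) :
    B (e i) (e j) = if j = i.rev then 1 else 0 := by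
  rw [he.form]
  congr 1
  rw [Fin.ext_iff, Fin.val_rev, eq_iff_iff]
  omega

lemma isSymm (he : IsAdaptedBasis B F e) : B.IsSymm :=
  LinearMap.BilinForm.isSymm_iff_basis e |>.2 fun i j => by
    simp only [he.form, add_comm ((i : ℕ) + 1)]

lemma apply_self_right (he : IsAdaptedBasis B F e) (x : V) (i : Fin N) :
    B x (e i) = e.repr x i.rev := by
  suffices B.flip (e i) = e.coord i.rev from LinearMap.congr_fun this x
  refine e.ext fun j => ?_
  rw [LinearMap.BilinForm.flip_apply, he.isSymm.eq, he.apply_self, Basis.coord_apply, e.repr_self,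
    Finsupp.single_apply]

lemma apply_eq_sum (he : IsAdaptedBasis B F e) (x y : V) :
    B x y = ∑ i, e.repr x i * e.repr y i.rev := by
  conv_lhs => rw [← e.sum_repr y, map_sum]
  rw [← Equiv.sum_comp Fin.revPerm]
  simp [he.apply_self_right, mul_comm]

lemma nondegenerate (he : IsAdaptedBasis B F e) : B.Nondegenerate := by
  refine he.isSymm.isRefl.nondegenerate_iff_separatingLeft.2 fun x hx => ?_
  refine e.ext_elem fun i => ?_
  rw [← i.rev_rev, ← he.apply_self_right, hx, map_zero, Finsupp.zero_apply]

lemma apply_eq_zero_of_mem_flag (he : IsAdaptedBasis B F e) {k l : Fin (N + 1)}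
    (hkl : (k : ℕ) + l ≤ N) {x y : V} (hx : x ∈ e.flag k) (hy : y ∈ e.flag l) : B x y = 0 := by
  rw [he.apply_eq_sum]
  refine Finset.sum_eq_zero fun i _ => ?_
  obtain hki | hik := le_or_gt k i.castSucc
  · rw [mem_flag_iff.1 hx i hki, zero_mul]
  · have hli : l ≤ i.rev.castSucc := by
      rw [Fin.lt_def, Fin.val_castSucc] at hik
      rw [Fin.le_def, Fin.val_castSucc, Fin.val_rev]
      omega
    rw [mem_flag_iff.1 hy i.rev hli, mul_zero]

lemma apply_smul_mem_flag (he : IsAdaptedBasis B F e) {i k l : Fin (N + 1)}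
    (hkl : (k : ℕ) + l ≤ N + 1) {x y z : V} (hx : x ∈ e.flag i) (hy : y ∈ e.flag l)
    (hz : z ∈ e.flag k) : B x y • z ∈ e.flag i := by
  obtain hil | hil := le_or_gt ((i : ℕ) + l) N
  · rw [he.apply_eq_zero_of_mem_flag hil hx hy, zero_smul]
    exact zero_mem _
  · exact Submodule.smul_mem _ _ (e.flag_mono (Fin.le_def.2 (by omega)) hz)

lemma eichler_mem_flag (he : IsAdaptedBasis B F e) {k l : Fin (N + 1)}
    (hkl : (k : ℕ) + l ≤ N + 1) {f a : V} (hf : f ∈ e.flag l) (ha : a ∈ e.flag k)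
    {i : Fin (N + 1)} {x : V} (hx : x ∈ e.flag i) : eichler B f a x ∈ e.flag i := by
  rw [eichler_apply, smul_comm, div_eq_inv_mul, mul_smul, smul_comm (B x f)]
  have hlk : (l : ℕ) + k ≤ N + 1 := by omega
  have haf : B a a • f ∈ e.flag k := he.apply_smul_mem_flag hlk ha ha hf
  exact sub_mem (sub_mem (add_mem hx (he.apply_smul_mem_flag hkl hx hf ha))
    (he.apply_smul_mem_flag hlk hx ha hf))
    (Submodule.smul_mem _ _ (he.apply_smul_mem_flag hkl hx hf haf))

lemma apply_ne_zero (he : IsAdaptedBasis B F e) {i : Fin N} {x y : V}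
    (hx : HasLeadingIndex e x i) (hy : HasLeadingIndex e y i.rev) : B x y ≠ 0 := by
  rw [he.apply_eq_sum, Finset.sum_eq_single i]
  · exact mul_ne_zero hx.2 hy.2
  · intro j _ hji
    obtain hij | hij := hji.lt_or_gt.symm
    · rw [mem_flag_iff.1 hx.1 j (Fin.succ_le_castSucc_iff.2 hij), zero_mul]
    · rw [mem_flag_iff.1 hy.1 j.rev (Fin.succ_le_castSucc_iff.2 (Fin.rev_lt_rev.2 hij)), mul_zero]
  · exact fun h => (h (Finset.mem_univ i)).elim

lemma rev_notMem_leadingIndices (he : IsAdaptedBasis B F e) {S : Submodule ℂ V}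
    (hS : ∀ x ∈ S, ∀ y ∈ S, B x y = 0) {i : Fin N} (hi : i ∈ leadingIndices e S) :
    i.rev ∉ leadingIndices e S := by
  intro hr
  obtain ⟨x, hxS, hx⟩ := mem_leadingIndices.1 hi
  obtain ⟨y, hyS, hy⟩ := mem_leadingIndices.1 hr
  exact he.apply_ne_zero hx hy (hS x hxS y hyS)

end IsAdaptedBasis

end AdaptedBasis

lemma lt_card_filter_le_iff {α : Type*} [LinearOrder α] {m : ℕ} (f : Fin m ↪o α) (j : Fin m)
    (a : α) : (j : ℕ) < (Finset.univ.filter fun i => f i ≤ a).card ↔ f j ≤ a := by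
  constructor
  · contrapose!
    intro ha
    rw [← Fin.card_Iio]
    refine Finset.card_le_card fun i hi => Finset.mem_Iio.2 (f.lt_iff_lt.1 ?_)
    exact (Finset.mem_filter_univ _ |>.1 hi).trans_lt ha
  · intro ha
    rw [← Nat.succ_le_iff, Nat.succ_eq_add_one, ← Fin.card_Iic]
    refine Finset.card_le_card fun i hi => Finset.mem_filter_univ _ |>.2 (le_trans ?_ ha)
    exact f.le_iff_le.2 (Finset.mem_Iic.1 hi)

namespace IndexSet

variable {N m : ℕ} (P : IndexSet N m)

lemma range_elem : Set.range P.elem = P.carrier := P.carrier.range_orderEmbOfFin P.card_eq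

lemma map_elem_univ : Finset.univ.map P.elem.toEmbedding = P.carrier :=
  P.carrier.map_orderEmbOfFin_univ P.card_eq

lemma carrier_injective : Function.Injective (carrier : IndexSet N m → Finset (Fin N)) := by
  rintro ⟨_, _, _⟩ ⟨_, _, _⟩ rfl
  rfl

lemma ext_elem {P Q : IndexSet N m} (h : ∀ j, P.elem j = Q.elem j) : P = Q :=
  carrier_injective (by rw [← map_elem_univ, ← map_elem_univ, RelEmbedding.ext h])

lemma elem_mem_carrier (j : Fin m) : P.elem j ∈ P.carrier :=
  P.carrier.orderEmbOfFin_mem P.card_eq j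

lemma elem_ne_rev (i j : Fin m) : P.elem i ≠ (P.elem j).rev := fun h =>
  P.add_ne _ (P.elem_mem_carrier i) _ (P.elem_mem_carrier j) (by
    rw [h, Fin.val_rev]
    omega)

lemma elem_add_elem_add_one_ne (P : IndexSet N m) (i j : Fin m) :
    (P.elem i + P.elem j + 1 : ℕ) ≠ N := fun h =>
  P.elem_ne_rev i j (Fin.ext (by rw [Fin.val_rev]; omega))

end IndexSet

section SchubertCells

variable {V : Type*} [AddCommGroup V] [Module ℂ V] {N m : ℕ} {B : LinearMap.BilinForm ℂ V}
  {F : Fin (N + 1) → Submodule ℂ V} {e : Basis (Fin N) ℂ V}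

/-- The isometries of `V` that stabilize the flag `F`. Compared with `borel`, no condition is
imposed on the determinant. -/
structure IsFlagIsometry (B : LinearMap.BilinForm ℂ V) (F : Fin (N + 1) → Submodule ℂ V)
    (g : V ≃ₗ[ℂ] V) : Prop where
  apply_apply : ∀ x y, B (g x) (g y) = B x y
  map_flag : ∀ i, (F i).map (g : V →ₗ[ℂ] V) = F i

namespace IsFlagIsometry

variable {g h : V ≃ₗ[ℂ] V}

lemma of_mem_borel (hg : g ∈ borel B F) : IsFlagIsometry B F g := ⟨hg.1.1, hg.2⟩

lemma refl : IsFlagIsometry B F (LinearEquiv.refl ℂ V) :=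
  ⟨fun _ _ => rfl, fun _ => Submodule.map_id _⟩

lemma trans (hg : IsFlagIsometry B F g) (hh : IsFlagIsometry B F h) :
    IsFlagIsometry B F (g.trans h) :=
  ⟨fun x y => by simp [hg.apply_apply, hh.apply_apply], fun i => by
    rw [LinearEquiv.coe_trans, Submodule.map_comp, hg.map_flag, hh.map_flag]⟩

lemma apply_mem_flag_iff (hg : IsFlagIsometry B F g) {i : Fin (N + 1)} {x : V} :
    g x ∈ F i ↔ x ∈ F i := by
  conv_lhs => rw [← hg.map_flag i]
  exact g.injective.mem_set_image

lemma hasLeadingIndex_iff (he : IsAdaptedBasis B F e) (hg : IsFlagIsometry B F g) {x : V}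
    {i : Fin N} : HasLeadingIndex e (g x) i ↔ HasLeadingIndex e x i := by
  simp only [hasLeadingIndex_iff_notMem, ← he.flag_eq, hg.apply_mem_flag_iff]

lemma leadingIndices_comap (he : IsAdaptedBasis B F e) (hg : IsFlagIsometry B F g)
    (S : Submodule ℂ V) : leadingIndices e (S.comap (g : V →ₗ[ℂ] V)) = leadingIndices e S := by
  ext i
  conv_rhs => rw [mem_leadingIndices, g.surjective.exists]
  simp [mem_leadingIndices, hg.hasLeadingIndex_iff he]

lemma leadingIndices_map (he : IsAdaptedBasis B F e) (hg : IsFlagIsometry B F g)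
    (S : Submodule ℂ V) : leadingIndices e (S.map (g : V →ₗ[ℂ] V)) = leadingIndices e S := by
  rw [← hg.leadingIndices_comap he, Submodule.comap_map_eq_of_injective g.injective]

lemma det_eq_one_or_neg_one (he : IsAdaptedBasis B F e) (hg : IsFlagIsometry B F g) :
    LinearMap.det (g : V →ₗ[ℂ] V) = 1 ∨ LinearMap.det (g : V →ₗ[ℂ] V) = -1 := by
  have hgram := (LinearMap.BilinForm.nondegenerate_iff_det_ne_zero e).1 he.nondegenerate
  have hcomp : B.comp (g : V →ₗ[ℂ] V) (g : V →ₗ[ℂ] V) = B := by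
    ext x y
    simp [hg.apply_apply]
  have hdet := congrArg Matrix.det
    (LinearMap.BilinForm.toMatrix_comp e e B (g : V →ₗ[ℂ] V) (g : V →ₗ[ℂ] V))
  rw [hcomp, Matrix.det_mul, Matrix.det_mul, Matrix.det_transpose, LinearMap.det_toMatrix] at hdet
  refine mul_self_eq_one_iff.1 (mul_right_cancel₀ hgram ?_)
  linear_combination -hdet

/-- In odd dimension `-1` is an isometry of determinant `-1` that fixes every subspace. -/
lemma exists_mem_borel (hN : Odd N) (he : IsAdaptedBasis B F e) (hg : IsFlagIsometry B F g) :
    ∃ g' ∈ borel B F, ∀ W : Submodule ℂ V, W.map (g' : V →ₗ[ℂ] V) = W.map (g : V →ₗ[ℂ] V) := by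
  obtain hdet | hdet := hg.det_eq_one_or_neg_one he
  · refine ⟨g, ⟨⟨hg.apply_apply, Units.ext ?_⟩, hg.map_flag⟩, fun _ => rfl⟩
    rw [LinearEquiv.coe_det, hdet, Units.val_one]
  · have hneg : (g.trans (LinearEquiv.neg ℂ) : V →ₗ[ℂ] V) = -(g : V →ₗ[ℂ] V) := rfl
    have hmap (W : Submodule ℂ V) :
        W.map (g.trans (LinearEquiv.neg ℂ) : V →ₗ[ℂ] V) = W.map (g : V →ₗ[ℂ] V) := by
      rw [hneg, Submodule.map_neg]
    refine ⟨g.trans (LinearEquiv.neg ℂ), ⟨⟨fun x y => by simp [hg.apply_apply], Units.ext ?_⟩,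
      fun i => (hmap _).trans (hg.map_flag i)⟩, hmap⟩
    rw [LinearEquiv.coe_det, hneg, ← neg_one_smul ℂ (g : V →ₗ[ℂ] V), LinearMap.det_smul, hdet,
      finrank_eq_card_basis e, Fintype.card_fin, hN.neg_one_pow, Units.val_one, neg_one_mul,
      neg_neg]

end IsFlagIsometry

namespace IsAdaptedBasis

lemma isFlagIsometry_eichlerEquiv (he : IsAdaptedBasis B F e) {k l : Fin (N + 1)}
    (hkl : (k : ℕ) + l ≤ N + 1) {f a : V} (hf : B f f = 0) (haf : B a f = 0)
    (hfl : f ∈ e.flag l) (hak : a ∈ e.flag k) :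
    IsFlagIsometry B F (eichlerEquiv he.isSymm hf haf) := by
  have := e.finiteDimensional_of_finite
  refine ⟨apply_eichler_eichler he.isSymm hf haf, fun i => ?_⟩
  rw [congrFun he.flag_eq i]
  exact Submodule.eq_of_le_of_finrank_eq
    (Submodule.map_le_iff_le_comap.2 fun x hx => he.eichler_mem_flag hkl hfl hak hx)
    (LinearEquiv.finrank_map_eq _ _)

lemma exists_isFlagIsometry_apply_self (he : IsAdaptedBasis B F e) {q : Fin N} (hq : q ≠ q.rev)
    {u : V} (hu : B u u = 0) (huq : u ∈ e.flag q.succ) (hrepr : e.repr u q = 1) :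
    ∃ g : V ≃ₗ[ℂ] V, IsFlagIsometry B F g ∧ g (e q) = u ∧
      ∀ x, B x u = 0 → B x (e q) = 0 → B x (e q.rev) = 0 → g x = x := by
  have hff : B (e q.rev) (e q.rev) = 0 := by rw [he.apply_self, Fin.rev_rev, if_neg hq.symm]
  have hqf : B (e q) (e q.rev) = 1 := by rw [he.apply_self, if_pos rfl]
  have hqq : B (e q) (e q) = 0 := by rw [he.apply_self, if_neg hq]
  have haf : B (u - e q) (e q.rev) = 0 := by
    rw [map_sub, LinearMap.sub_apply, hqf, he.apply_self_right, Fin.rev_rev, hrepr, sub_self]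
  have haq : u - e q ∈ e.flag q.castSucc :=
    (mem_flag_castSucc_iff e).2
      ⟨sub_mem huq (e.self_mem_flag q.castSucc_lt_succ), by simp [hrepr]⟩
  refine ⟨eichlerEquiv he.isSymm hff haf, he.isFlagIsometry_eichlerEquiv ?_ hff haf
    (e.self_mem_flag q.rev.castSucc_lt_succ) haq, ?_, fun x hxu hxq hxf => ?_⟩
  · rw [Fin.val_castSucc, Fin.val_succ, Fin.val_rev]
    omega
  · have haa : B (u - e q) (u - e q) = -2 * B (e q) (u - e q) := by
      simp only [map_sub, LinearMap.sub_apply, hu, hqq, he.isSymm.eq u (e q)]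
      ring
    change eichler B (e q.rev) (u - e q) (e q) = u
    rw [eichler_apply, hqf, haa]
    module
  · change eichler B (e q.rev) (u - e q) x = x
    simp [eichler_apply, hxf, hxu, hxq]

variable {S : Submodule ℂ V}

lemma exists_isFlagIsometry_apply_self_mem (he : IsAdaptedBasis B F e)
    (hS : ∀ x ∈ S, ∀ y ∈ S, B x y = 0) {q : Fin N} (hq : q ∈ leadingIndices e S) :
    ∃ g : V ≃ₗ[ℂ] V, IsFlagIsometry B F g ∧ g (e q) ∈ S ∧
      ∀ i, i ≠ q → e i ∈ S → g (e i) = e i := by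
  obtain ⟨u, huS, hu, huq⟩ := mem_leadingIndices.1 hq
  have hrev {i : Fin N} (hi : i ∈ leadingIndices e S) : q ≠ i.rev := fun h =>
    he.rev_notMem_leadingIndices hS hi (h ▸ hq)
  have hwS : (e.repr u q)⁻¹ • u ∈ S := S.smul_mem _ huS
  obtain ⟨g, hg, hgq, hgx⟩ := he.exists_isFlagIsometry_apply_self (hrev hq) (hS _ hwS _ hwS)
    (Submodule.smul_mem _ _ hu) (by simp [huq])
  refine ⟨g, hg, hgq ▸ hwS, fun i hiq hi => hgx _ (hS _ hi _ hwS) ?_ ?_⟩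
  · rw [he.apply_self, if_neg (hrev (mem_leadingIndices.2 ⟨_, hi, hasLeadingIndex_self e i⟩))]
  · rw [he.apply_self, if_neg (Fin.rev_injective.ne hiq.symm)]

lemma exists_isFlagIsometry_forall_apply_self_mem (he : IsAdaptedBasis B F e)
    (hS : ∀ x ∈ S, ∀ y ∈ S, B x y = 0) {A : Finset (Fin N)} (hA : A ⊆ leadingIndices e S) :
    ∃ g : V ≃ₗ[ℂ] V, IsFlagIsometry B F g ∧ ∀ i ∈ A, g (e i) ∈ S := by
  induction A using Finset.induction_on with
  | empty => exact ⟨_, .refl, by simp⟩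
  | insert q A hqA ih =>
    obtain ⟨hqS, hAS⟩ := Finset.insert_subset_iff.1 hA
    obtain ⟨g, hg, hgA⟩ := ih hAS
    obtain ⟨h, hh, hhq, hhi⟩ := he.exists_isFlagIsometry_apply_self_mem (q := q)
      (S := S.comap (g : V →ₗ[ℂ] V)) (fun x hx y hy => hg.apply_apply x y ▸ hS _ hx _ hy)
      (hg.leadingIndices_comap he S ▸ hqS)
    refine ⟨h.trans g, hh.trans hg, Finset.forall_mem_insert _ _ _ |>.2 ⟨hhq, fun i hi => ?_⟩⟩
    rw [LinearEquiv.trans_apply, hhi i (ne_of_mem_of_not_mem hi hqA) (hgA i hi)]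
    exact hgA i hi

/-- The leading indices of an isotropic subspace, as an index set. -/
noncomputable def leadingIndexSet (he : IsAdaptedBasis B F e) (S : OG B m) : IndexSet N m where
  carrier := leadingIndices e S.1
  card_eq := by rw [← finrank_eq_card_leadingIndices, S.2.1]
  add_ne i hi j hj hij := he.rev_notMem_leadingIndices S.2.2 hi (by
    rwa [show i.rev = j by rw [Fin.ext_iff, Fin.val_rev]; omega])

end IsAdaptedBasis

lemma leadingIndices_span_image (P : IndexSet N m) :
    leadingIndices e (Submodule.span ℂ (e '' P.carrier)) = P.carrier := by
  rw [← P.range_elem, ← Set.range_comp, ← P.map_elem_univ]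
  exact leadingIndices_span fun j => hasLeadingIndex_self e (P.elem j)

theorem mem_schubertCell_iff (hN : Odd N) (he : IsAdaptedBasis B F e) {P : IndexSet N m}
    {S : OG B m} : S ∈ schubertCell B F e P ↔ he.leadingIndexSet S = P := by
  rw [← IndexSet.carrier_injective.eq_iff, IsAdaptedBasis.leadingIndexSet]
  constructor
  · rintro ⟨g, hg, hS⟩
    simp only [hS, (IsFlagIsometry.of_mem_borel hg).leadingIndices_map he,
      leadingIndices_span_image]
  · intro hS
    have := e.finiteDimensional_of_finite
    obtain ⟨g, hg, hgS⟩ := he.exists_isFlagIsometry_forall_apply_self_mem S.2.2 subset_rfl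
    obtain ⟨g', hg', hmap⟩ := hg.exists_mem_borel hN he
    refine ⟨g', hg', .symm ?_⟩
    rw [hmap]
    refine Submodule.eq_of_le_of_finrank_eq ?_ ?_
    · rw [Submodule.map_span_le, Set.forall_mem_image, ← hS]
      exact hgS
    · rw [LinearEquiv.finrank_map_eq, finrank_eq_card_leadingIndices e,
        leadingIndices_span_image, P.card_eq, S.2.1]

theorem IsAdaptedBasis.mem_rankLocus_iff (he : IsAdaptedBasis B F e) {P : IndexSet N m}
    {S : OG B m} : S ∈ rankLocus B F P ↔ he.leadingIndexSet S ≤ P := by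
  refine forall_congr' fun j => ?_
  rw [Nat.succ_le_iff, congrFun he.flag_eq _, finrank_inf_flag, ← lt_card_filter_le_iff,
    show leadingIndices e S.1 = (he.leadingIndexSet S).carrier from rfl, ← IndexSet.map_elem_univ,
    Finset.filter_map, Finset.card_map]
  simp only [Function.comp_def, Fin.castSucc_lt_succ_iff, RelEmbedding.coe_toEmbedding]

end SchubertCells

namespace IndexSet

variable {N m : ℕ} {P Q : IndexSet N m}

lemma exists_elem_eq {f : Fin m → Fin N} (hf : StrictMono f) (hrev : ∀ i j, f i ≠ (f j).rev) :
    ∃ P : IndexSet N m, ∀ j, P.elem j = f j := by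
  let P : IndexSet N m :=
    { carrier := Finset.univ.map ⟨f, hf.injective⟩
      card_eq := by rw [Finset.card_map, Finset.card_fin]
      add_ne := by
        simp only [Finset.forall_mem_map, Finset.mem_univ, true_imp_iff,
          Function.Embedding.coeFn_mk]
        intro i j hij
        refine hrev i j (Fin.ext ?_)
        rw [Fin.val_rev]
        omega }
  have hP := P.carrier.orderEmbOfFin_unique P.card_eq (f := f)
    (fun j => Finset.mem_map_of_mem _ (Finset.mem_univ j)) hf
  exact ⟨P, fun j => (congrFun hP j).symm⟩

/-- `P'` arises from `P` by a basic degeneration. Either one element of `P` is decreased, or two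
elements `a`, `b` of `P` are replaced by `rev b < a` and `rev a < b`. -/
inductive IsStep (P P' : IndexSet N m) : Prop
  | single (j : Fin m) (hlt : P'.elem j < P.elem j) (heq : ∀ i, i ≠ j → P'.elem i = P.elem i)
  | double (j k : Fin m) (hjk : j ≠ k) (hj : P'.elem j = (P.elem k).rev)
      (hk : P'.elem k = (P.elem j).rev) (hlt : P'.elem j < P.elem j)
      (heq : ∀ i, i ≠ j → i ≠ k → P'.elem i = P.elem i)

lemma exists_isStep_single {j : Fin m} {x : Fin N} (hQP : Q ≤ P) (hlt : x < P.elem j)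
    (hQx : Q.elem j ≤ x) (hnot : ∀ i, i ≠ j → P.elem i < P.elem j → P.elem i < x)
    (hx : x ≠ x.rev) (hrev : ∀ i, i ≠ j → P.elem i ≠ x.rev) : ∃ P', IsStep P P' ∧ Q ≤ P' := by
  have hmono : StrictMono (Function.update P.elem j x) := by
    intro a b hab
    have hPab := P.elem.strictMono hab
    obtain rfl | ha := eq_or_ne a j
    · rw [Function.update_self, Function.update_of_ne hab.ne']
      exact hlt.trans hPab
    obtain rfl | hb := eq_or_ne b j
    · rw [Function.update_self, Function.update_of_ne hab.ne]
      exact hnot a ha hPab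
    · rwa [Function.update_of_ne ha, Function.update_of_ne hb]
  have hne_rev (a b : Fin m) :
      Function.update P.elem j x a ≠ (Function.update P.elem j x b).rev := by
    simp only [Function.update_apply]
    split_ifs with ha hb hb
    · exact hx
    · exact fun h => hrev b hb (by rw [h, Fin.rev_rev])
    · exact hrev a ha
    · exact P.elem_ne_rev a b
  obtain ⟨P', hP'⟩ := exists_elem_eq hmono hne_rev
  have hj : P'.elem j = x := by rw [hP', Function.update_self]
  have hne (i : Fin m) (hi : i ≠ j) : P'.elem i = P.elem i := by
    rw [hP', Function.update_of_ne hi]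
  refine ⟨P', .single j (hj ▸ hlt) hne, fun i => ?_⟩
  obtain rfl | hi := eq_or_ne i j
  · rwa [hj]
  · rw [hne i hi]
    exact hQP i

lemma exists_elem_add_ite_eq {j k : Fin m} (hsum : (P.elem j + P.elem k : ℕ) = N) :
    ∃ P' : IndexSet N m, ∀ i,
      (P'.elem i + if i = j ∨ i = k then 1 else 0 : ℕ) = P.elem i := by
  have hinj (a b : Fin m) (h : (P.elem a : ℕ) = P.elem b) : a = b := P.elem.injective (Fin.ext h)
  have hrev := P.elem_add_elem_add_one_ne
  let f (i : Fin m) : Fin N :=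
    ⟨P.elem i - if i = j ∨ i = k then 1 else 0, (Nat.sub_le _ _).trans_lt (P.elem i).2⟩
  have hf (i : Fin m) : (f i + if i = j ∨ i = k then 1 else 0 : ℕ) = P.elem i := by
    refine Nat.sub_add_cancel ?_
    split_ifs <;> grind
  have hmono : StrictMono f := by
    intro a b hab
    have hPab := Fin.lt_def.1 (P.elem.strictMono hab)
    have hfa := hf a
    have hfb := hf b
    have haj := hrev a j
    have hak := hrev a k
    rw [Fin.lt_def]
    split_ifs at hfa hfb <;> grind
  have hne_rev (a b : Fin m) : f a ≠ (f b).rev := by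
    intro h
    have hfa := hf a
    have hfb := hf b
    have hjj := hrev j j
    have hkk := hrev k k
    have hab := hrev a b
    rw [Fin.ext_iff, Fin.val_rev] at h
    split_ifs at hfa hfb <;> grind
  obtain ⟨P', hP'⟩ := exists_elem_eq hmono hne_rev
  exact ⟨P', fun i => hP' i ▸ hf i⟩

lemma exists_isStep_double {j k : Fin m} (hQP : Q ≤ P) (hjk : j ≠ k)
    (hsum : (P.elem j + P.elem k : ℕ) = N) (hQj : Q.elem j < P.elem j)
    (hQk : Q.elem k < P.elem k) : ∃ P', IsStep P P' ∧ Q ≤ P' := by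
  obtain ⟨P', hP'⟩ := exists_elem_add_ite_eq hsum
  have hj := hP' j
  have hk := hP' k
  rw [if_pos (.inl rfl)] at hj
  rw [if_pos (.inr rfl)] at hk
  refine ⟨P', .double j k hjk (Fin.ext ?_) (Fin.ext ?_) (Fin.lt_def.2 ?_) fun i hij hik => ?_,
    fun i => ?_⟩
  · rw [Fin.val_rev]
    omega
  · rw [Fin.val_rev]
    omega
  · omega
  · exact Fin.ext (by simpa [hij, hik] using hP' i)
  · have hi := hP' i
    have hQi := hQP i
    rw [Fin.le_def]
    split_ifs at hi <;> grind

lemma exists_elem_add_add_one_eq {j : Fin m}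
    (hgap : ∀ i, P.elem i < P.elem j → P.elem i < Q.elem j)
    (hmirror : ∀ x, Q.elem j ≤ x → x < P.elem j → x ≠ x.rev → ∃ i, i ≠ j ∧ P.elem i = x.rev)
    {x : Fin N} (hQx : Q.elem j ≤ x) (hxP : x < P.elem j) :
    ∃ i, i ≠ j ∧ (P.elem i + x + 1 : ℕ) = N := by
  have hmiddle (y : Fin N) (hQy : Q.elem j ≤ y) (hyP : y < P.elem j) : y ≠ y.rev := by
    intro hy
    have hQj := Q.elem_add_elem_add_one_ne j j
    rw [Fin.ext_iff, Fin.val_rev] at hy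
    rw [Fin.le_def] at hQy
    have hlt : (y : ℕ) - 1 < N := by omega
    obtain ⟨i, hij, hi⟩ := hmirror ⟨y - 1, hlt⟩ (Fin.le_def.2 (by grind)) (by grind) (by grind)
    have hPi : P.elem j ≤ P.elem i := not_lt.1 fun h => by grind
    refine hij (P.elem.injective (Fin.ext ?_))
    grind
  obtain ⟨i, hij, hi⟩ := hmirror x hQx hxP (hmiddle x hQx hxP)
  refine ⟨i, hij, ?_⟩
  rw [hi, Fin.val_rev]
  omega

lemma elem_lt_elem_of_add_add_one_eq (hQP : Q ≤ P) {j : Fin m}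
    (hmirror : ∀ x, Q.elem j ≤ x → x < P.elem j → ∃ i, (P.elem i + x + 1 : ℕ) = N)
    {x : ℕ} (hQx : Q.elem j ≤ x) :
    x < P.elem j → ∀ i, (P.elem i + x + 1 : ℕ) = N → Q.elem i < P.elem i := by
  induction x, hQx using Nat.le_induction with
  | base =>
    intro _ i hi
    refine (hQP i).lt_of_ne fun h => Q.elem_add_elem_add_one_ne i j ?_
    rwa [h]
  | succ x hQx ih =>
    intro hxP i hi
    have hlt : x < P.elem j := by omega
    obtain ⟨k, hk⟩ := hmirror ⟨x, by omega⟩ hQx (Fin.lt_def.2 hlt)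
    have hQk := ih hlt k hk
    have hik : Q.elem i < Q.elem k :=
      Q.elem.strictMono (P.elem.lt_iff_lt.1 (Fin.lt_def.2 (by grind)))
    grind

/-- The smallest element in which `P` exceeds `Q` can be lowered by one unless its new mirror image
lies in `P`, in which case that element has room above `Q` as well and both can be lowered. -/
theorem exists_isStep (hQP : Q ≤ P) (hne : Q ≠ P) : ∃ P', IsStep P P' ∧ Q ≤ P' := by
  have hex : ∃ j, Q.elem j ≠ P.elem j := not_forall.1 (mt ext_elem hne)
  obtain ⟨j, hj, hmin⟩ := WellFounded.has_min (wellFounded_lt (α := Fin m)) _ hex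
  have hgap (i : Fin m) (hi : P.elem i < P.elem j) : P.elem i < Q.elem j := by
    have hij := P.elem.lt_iff_lt.1 hi
    rw [← not_not.1 fun h => hmin i h hij]
    exact Q.elem.strictMono hij
  have hQj : Q.elem j < P.elem j := (hQP j).lt_of_ne hj
  by_cases hfree : ∃ x, Q.elem j ≤ x ∧ x < P.elem j ∧ x ≠ x.rev ∧ ∀ i, i ≠ j → P.elem i ≠ x.rev
  · obtain ⟨x, hQx, hxP, hx, hrev⟩ := hfree
    exact exists_isStep_single hQP hxP hQx (fun i _ hi => (hgap i hi).trans_le hQx) hx hrev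
  push Not at hfree
  have hmirror (x : Fin N) (hQx : Q.elem j ≤ x) (hxP : x < P.elem j) :=
    exists_elem_add_add_one_eq hgap hfree hQx hxP
  have hlt : (P.elem j : ℕ) - 1 < P.elem j := by grind
  obtain ⟨k, hkj, hk⟩ := hmirror ⟨P.elem j - 1, by omega⟩ (Fin.le_def.2 (by grind)) hlt
  refine exists_isStep_double hQP hkj.symm (by grind) hQj ?_
  exact elem_lt_elem_of_add_add_one_eq hQP
    (fun x hQx hxP => (hmirror x hQx hxP).imp fun _ => And.right)
    (Nat.le_sub_one_of_lt hQj) hlt k hk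

lemma IsStep.sum_elem_lt {P' : IndexSet N m} (h : IsStep P P') :
    ∑ i, (P'.elem i : ℕ) < ∑ i, (P.elem i : ℕ) := by
  cases h with
  | single j hlt heq =>
    refine Finset.sum_lt_sum (fun i _ => ?_) ⟨j, Finset.mem_univ j, hlt⟩
    obtain rfl | hi := eq_or_ne i j
    · exact hlt.le
    · rw [heq i hi]
  | double j k _ hj hk hlt heq =>
    have hlt' : P'.elem k < P.elem k := by rwa [hk, Fin.rev_lt_iff, ← hj]
    refine Finset.sum_lt_sum (fun i _ => ?_) ⟨j, Finset.mem_univ j, hlt⟩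
    obtain rfl | hij := eq_or_ne i j
    · exact hlt.le
    obtain rfl | hik := eq_or_ne i k
    · exact hlt'.le
    · rw [heq i hij hik]

theorem reflTransGen_isStep (hQP : Q ≤ P) : Relation.ReflTransGen IsStep P Q := by
  induction hn : ∑ i, (P.elem i : ℕ) using Nat.strong_induction_on generalizing P with
  | _ n ih =>
    by_cases hne : Q = P
    · rw [hne]
    · obtain ⟨P', hstep, hQP'⟩ := exists_isStep hQP hne
      exact .head hstep (ih _ (hn ▸ hstep.sum_elem_lt) hQP' rfl)

end IndexSet

lemma eval_smul_of_isHomogeneous {R σ : Type*} [CommSemiring R] {f : MvPolynomial σ R} {d : ℕ}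
    (hf : f.IsHomogeneous d) (c : R) (x : σ → R) :
    MvPolynomial.eval (c • x) f = c ^ d * MvPolynomial.eval x f := by
  rw [MvPolynomial.eval_eq, MvPolynomial.eval_eq, Finset.mul_sum]
  refine Finset.sum_congr rfl fun k hk => ?_
  have hdeg : ∑ i ∈ k.support, k i = d := by
    rw [← hf (MvPolynomial.mem_support_iff.1 hk), Finsupp.weight_apply, Finsupp.sum]
    simp
  simp only [Pi.smul_apply, smul_eq_mul, mul_pow, Finset.prod_mul_distrib,
    Finset.prod_pow_eq_pow_sum, hdeg]
  ring

section ZariskiTopology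

variable {V : Type*} [AddCommGroup V] [Module ℂ V] {m : ℕ} {B : LinearMap.BilinForm ℂ V}

lemma pluecker_basis_change {S : Submodule ℂ V} (v w : Basis (Fin m) ℂ S) :
    pluecker (fun b => (w b : V)) = (v.toMatrix w).det • pluecker (fun b => (v b : V)) := by
  ext φ
  rw [Pi.smul_apply, smul_eq_mul, pluecker, pluecker, mul_comm, ← Matrix.det_mul]
  congr 1
  ext a b
  have hw : (w b : V) = ∑ c, v.toMatrix w c b • (v c : V) := by
    conv_lhs => rw [← v.sum_toMatrix_smul_self w b]
    simp only [Submodule.coe_sum, Submodule.coe_smul]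
  simp [hw, Matrix.mul_apply, mul_comm]

lemma eq_zero_of_pluecker_ne_zero {S : Submodule ℂ V} {v : Basis (Fin m) ℂ S}
    {φ : Fin m → Dual ℂ V} (hφ : pluecker (fun b => (v b : V)) φ ≠ 0) {x : S}
    (hx : ∀ a, φ a x = 0) : x = 0 := by
  have hrepr : (v.repr x : Fin m → ℂ) = 0 := by
    refine Matrix.eq_zero_of_mulVec_eq_zero hφ (funext fun a => ?_)
    have hsum : (x : V) = ∑ c, v.repr x c • (v c : V) := by
      conv_lhs => rw [← v.sum_repr x]
      simp only [Submodule.coe_sum, Submodule.coe_smul]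
    have hxa := hx a
    rw [hsum, map_sum] at hxa
    simpa [Matrix.mulVec, dotProduct, mul_comm] using hxa
  exact v.repr.map_eq_zero_iff.1 (DFunLike.coe_injective hrepr)

lemma isOpen_nonvanishing {f : MvPolynomial (Fin m → Dual ℂ V) ℂ} {d : ℕ}
    (hf : f.IsHomogeneous d) : IsOpen (nonvanishing B m f) :=
  TopologicalSpace.isOpen_generateFrom_of_mem ⟨d, f, hf, rfl⟩

lemma mem_nonvanishing_iff {S : OG B m} {f : MvPolynomial (Fin m → Dual ℂ V) ℂ} {d : ℕ}
    (hf : f.IsHomogeneous d) (v : Basis (Fin m) ℂ S.1) :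
    S ∈ nonvanishing B m f ↔ MvPolynomial.eval (pluecker fun b => (v b : V)) f ≠ 0 := by
  refine ⟨?_, fun hv => ⟨v, hv⟩⟩
  rintro ⟨w, hw⟩
  rw [pluecker_basis_change v w, eval_smul_of_isHomogeneous hf] at hw
  exact right_ne_zero_of_mul hw

lemma isOpen_setOf_disjoint [FiniteDimensional ℂ V] (D : Submodule ℂ V) :
    IsOpen {S : OG B m | Disjoint S.1 D} := by
  refine isOpen_iff_forall_mem_open.2 fun S hS => ?_
  obtain ⟨D', hD, hD'⟩ := hS.symm.exists_isCompl
  let v := finBasisOfFinrankEq ℂ S.1 S.2.1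
  let φ (a : Fin m) : Dual ℂ V := v.coord a ∘ₗ S.1.projectionOnto D' hD'.symm
  have hφ := MvPolynomial.isHomogeneous_X ℂ φ
  refine ⟨nonvanishing B m (MvPolynomial.X φ), ?_, isOpen_nonvanishing hφ, ?_⟩
  · rintro T ⟨w, hw⟩
    rw [MvPolynomial.eval_X] at hw
    refine Submodule.disjoint_def.2 fun x hxT hxD => ?_
    have hx (a : Fin m) : φ a x = 0 := by
      simp [φ, Submodule.projectionOnto_apply_of_mem_right hD'.symm (hD hxD)]
    exact congrArg Subtype.val (eq_zero_of_pluecker_ne_zero hw (x := ⟨x, hxT⟩) hx)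
  · have hone : (Matrix.of fun a b => φ a (v b)) = 1 := by
      ext a b
      simp [φ, Matrix.one_apply, Finsupp.single_apply, eq_comm]
    rw [mem_nonvanishing_iff hφ v, MvPolynomial.eval_X, pluecker, hone, Matrix.det_one]
    exact one_ne_zero

theorem isClosed_setOf_le_finrank_inf [FiniteDimensional ℂ V] (W : Submodule ℂ V) (d : ℕ) :
    IsClosed {S : OG B m | d ≤ finrank ℂ (S.1 ⊓ W : Submodule ℂ V)} := by
  refine isOpen_compl_iff.1 (isOpen_iff_forall_mem_open.2 fun S hS => ?_)
  obtain ⟨D, hD, hsup⟩ :=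
    IsModularLattice.exists_disjoint_and_sup_eq (inf_le_right : S.1 ⊓ W ≤ W)
  have hDW : D ≤ W := hsup ▸ le_sup_right
  refine ⟨{T | Disjoint T.1 D}, fun T hT (hTW : d ≤ _) => hS (hTW.trans ?_ : d ≤ _),
    isOpen_setOf_disjoint D, ?_⟩
  · have hTD : Disjoint (T.1 ⊓ W) D := Disjoint.mono_left inf_le_left hT
    have hle := Submodule.finrank_mono (sup_le inf_le_right hDW : T.1 ⊓ W ⊔ D ≤ W)
    have hT_add := Submodule.finrank_sup_add_finrank_inf_eq (T.1 ⊓ W) D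
    have hS_add := Submodule.finrank_sup_add_finrank_inf_eq (S.1 ⊓ W) D
    rw [hTD.eq_bot, finrank_bot] at hT_add
    rw [hsup, hD.eq_bot, finrank_bot] at hS_add
    omega
  · rw [disjoint_iff, inf_assoc, inf_eq_right.2 hDW] at hD
    exact disjoint_iff.2 hD

theorem isClosed_rankLocus [FiniteDimensional ℂ V] {N : ℕ} (F : Fin (N + 1) → Submodule ℂ V)
    (P : IndexSet N m) : IsClosed (rankLocus B F P) := by
  simp only [rankLocus, Set.ofPred_forall]
  exact isClosed_iInter fun j => isClosed_setOf_le_finrank_inf _ _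

variable {v : Fin m → V} (hv : LinearIndependent ℂ v) (hB : ∀ i j, B (v i) (v j) = 0)

/-- The point of the orthogonal Grassmannian spanned by independent, mutually orthogonal isotropic
vectors. -/
def spanPoint : OG B m :=
  ⟨Submodule.span ℂ (Set.range v), by rw [finrank_span_eq_card hv, Fintype.card_fin],
    fun x hx y hy => LinearMap.BilinMap.apply_apply_mem_of_mem_span ⊥ _ _ B
      (Set.forall_mem_range.2 fun i => Set.forall_mem_range.2 fun j => hB i j) x y hx hy⟩

lemma spanPoint_mem_nonvanishing_iff {f : MvPolynomial (Fin m → Dual ℂ V) ℂ} {d : ℕ}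
    (hf : f.IsHomogeneous d) :
    spanPoint hv hB ∈ nonvanishing B m f ↔ MvPolynomial.eval (pluecker v) f ≠ 0 := by
  let b : Basis (Fin m) ℂ (spanPoint hv hB).1 := Basis.span hv
  have hb : (fun i => (b i : V)) = v := funext (Basis.coe_span_apply hv)
  rw [mem_nonvanishing_iff hf b, hb]

theorem continuous_spanPoint {X : Type*} [TopologicalSpace X] {w : X → Fin m → V}
    (hw : ∀ s, LinearIndependent ℂ (w s)) (hB : ∀ s i j, B (w s i) (w s j) = 0)
    (hcont : ∀ (φ : Dual ℂ V) j, Continuous fun s => φ (w s j)) :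
    Continuous fun s => spanPoint (hw s) (hB s) := by
  refine continuous_generateFrom_iff.2 ?_
  rintro _ ⟨d, f, hf, rfl⟩
  have heval : Continuous fun s => MvPolynomial.eval (pluecker (w s)) f :=
    (MvPolynomial.continuous_eval f).comp <| continuous_pi fun φ =>
      Continuous.matrix_det (continuous_matrix fun a b => hcont (φ a) b)
  have hpre : (fun s => spanPoint (hw s) (hB s)) ⁻¹' nonvanishing B m f =
      {s | MvPolynomial.eval (pluecker (w s)) f ≠ 0} :=
    Set.ext fun _ => spanPoint_mem_nonvanishing_iff _ _ hf
  exact hpre ▸ isOpen_ne.preimage heval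

end ZariskiTopology

section Degenerations

lemma hasLeadingIndex_add_smul_self {K V : Type*} [Field K] [AddCommGroup V] [Module K V] {N : ℕ}
    {e : Basis (Fin N) K V} {i : Fin N} {x : V} (hx : x ∈ e.flag i.castSucc) {c : K}
    (hc : c ≠ 0) : HasLeadingIndex e (x + c • e i) i := by
  obtain ⟨hxi, hx0⟩ := (mem_flag_castSucc_iff e).1 hx
  refine ⟨add_mem hxi (Submodule.smul_mem _ _ (e.self_mem_flag i.castSucc_lt_succ)), ?_⟩
  simpa [hx0] using hc

variable {V : Type*} [AddCommGroup V] [Module ℂ V] {N m : ℕ} {B : LinearMap.BilinForm ℂ V}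
  {F : Fin (N + 1) → Submodule ℂ V} {e : Basis (Fin N) ℂ V} {P P' : IndexSet N m}

lemma spanPoint_mem_schubertCell (hN : Odd N) (he : IsAdaptedBasis B F e) {v : Fin m → V}
    (hv : ∀ j, HasLeadingIndex e (v j) (P.elem j)) (hB : ∀ i j, B (v i) (v j) = 0) :
    spanPoint (linearIndependent_of_hasLeadingIndex (i := P.elem.toEmbedding) hv) hB ∈
      schubertCell B F e P :=
  (mem_schubertCell_iff hN he).2 <| IndexSet.carrier_injective <|
    (leadingIndices_span (i := P.elem.toEmbedding) hv).trans P.map_elem_univ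

theorem schubertCell_subset_schubertVariety_of_curve (hN : Odd N) (he : IsAdaptedBasis B F e)
    {w : ℂ → Fin m → V} (hB : ∀ s i j, B (w s i) (w s j) = 0)
    (hcont : ∀ (φ : Dual ℂ V) j, Continuous fun s => φ (w s j))
    (hw : ∀ s ≠ 0, ∀ j, HasLeadingIndex e (w s j) (P.elem j))
    (hw_zero : ∀ j, w 0 j = e (P'.elem j)) :
    schubertCell B F e P' ⊆ schubertVariety B F e P := by
  rintro S ⟨g, hg, hS⟩
  have hg' := IsFlagIsometry.of_mem_borel hg
  have hlead (s : ℂ) (hs : s ≠ 0) (j : Fin m) : HasLeadingIndex e (g (w s j)) (P.elem j) :=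
    (hg'.hasLeadingIndex_iff he).2 (hw s hs j)
  have hlead_zero (j : Fin m) : HasLeadingIndex e (g (w 0 j)) (P'.elem j) :=
    (hg'.hasLeadingIndex_iff he).2 (hw_zero j ▸ hasLeadingIndex_self e _)
  have hli (s : ℂ) : LinearIndependent ℂ fun j => g (w s j) := by
    obtain rfl | hs := eq_or_ne s 0
    · exact linearIndependent_of_hasLeadingIndex (i := P'.elem.toEmbedding) hlead_zero
    · exact linearIndependent_of_hasLeadingIndex (i := P.elem.toEmbedding) (hlead s hs)
  have hgB (s : ℂ) (i j : Fin m) : B (g (w s i)) (g (w s j)) = 0 := by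
    rw [hg'.apply_apply, hB]
  have hlim : spanPoint (hli 0) (hgB 0) = S := by
    refine Subtype.ext ?_
    rw [hS, Submodule.map_span, ← P'.range_elem, ← Set.range_comp, ← Set.range_comp]
    simp only [spanPoint, hw_zero, Function.comp_def, LinearEquiv.coe_coe]
  have hcont_span := continuous_spanPoint hli hgB fun φ j => hcont (φ ∘ₗ (g : V →ₗ[ℂ] V)) j
  rw [← hlim]
  exact mem_closure_of_tendsto ((hcont_span.tendsto 0).mono_left nhdsWithin_le_nhds)
    (eventually_nhdsWithin_of_forall fun s (hs : s ∈ ({0} : Set ℂ)ᶜ) =>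
      spanPoint_mem_schubertCell hN he (hlead s hs) (hgB s))

lemma IsAdaptedBasis.apply_self_elem (he : IsAdaptedBasis B F e) (P : IndexSet N m)
    (i j : Fin m) : B (e (P.elem i)) (e (P.elem j)) = 0 := by
  rw [he.apply_self, if_neg (P.elem_ne_rev j i)]

lemma schubertCell_subset_schubertVariety_of_pencil (hN : Odd N) (he : IsAdaptedBasis B F e)
    {t : Fin m → ℂ} (heq : ∀ i, t i = 0 → P'.elem i = P.elem i)
    (hlt : ∀ i, t i ≠ 0 → P'.elem i < P.elem i)
    (hB : ∀ i l, t l * B (e (P'.elem i)) (e (P.elem l)) +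
      t i * B (e (P'.elem l)) (e (P.elem i)) = 0) :
    schubertCell B F e P' ⊆ schubertVariety B F e P := by
  refine schubertCell_subset_schubertVariety_of_curve hN he
    (w := fun s i => e (P'.elem i) + (s * t i) • e (P.elem i)) (fun s i l => ?_) (fun φ j => ?_)
    (fun s hs j => ?_) (fun j => by simp)
  · have hil := hB i l
    rw [he.isSymm.eq (e (P'.elem l))] at hil
    simp only [map_add, map_smul, LinearMap.add_apply, LinearMap.smul_apply, smul_eq_mul,
      he.apply_self_elem]
    linear_combination s * hil
  · simp only [map_add, map_smul]
    fun_prop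
  · obtain hj | hj := eq_or_ne (t j) 0
    · rw [hj, mul_zero, zero_smul, add_zero, heq j hj]
      exact hasLeadingIndex_self e _
    · exact hasLeadingIndex_add_smul_self
        (e.self_mem_flag (Fin.castSucc_lt_castSucc_iff.2 (hlt j hj))) (mul_ne_zero hs hj)

lemma schubertCell_subset_schubertVariety_of_single (hN : Odd N) (he : IsAdaptedBasis B F e)
    {j : Fin m} (hlt : P'.elem j < P.elem j) (heq : ∀ i, i ≠ j → P'.elem i = P.elem i)
    (hrev : P'.elem j ≠ (P.elem j).rev) :
    schubertCell B F e P' ⊆ schubertVariety B F e P := by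
  have hB (i l : Fin m) :
      (Pi.single j 1 : Fin m → ℂ) l * B (e (P'.elem i)) (e (P.elem l)) = 0 := by
    obtain rfl | hl := eq_or_ne l j
    · obtain rfl | hi := eq_or_ne i l
      · rw [he.isSymm.eq, he.apply_self, if_neg hrev, mul_zero]
      · rw [heq i hi, he.apply_self_elem, mul_zero]
    · rw [Pi.single_eq_of_ne hl, zero_mul]
  refine schubertCell_subset_schubertVariety_of_pencil hN he (t := Pi.single j 1) (fun i hi => ?_)
    (fun i hi => ?_) fun i l => by rw [hB, hB, add_zero]
  · exact heq i fun h => by simp [h] at hi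
  · obtain rfl : i = j := not_not.1 fun h => hi (Pi.single_eq_of_ne h 1)
    exact hlt

lemma schubertCell_subset_schubertVariety_of_double (hN : Odd N) (he : IsAdaptedBasis B F e)
    {j k : Fin m} (hjk : j ≠ k) (hj : P'.elem j = (P.elem k).rev)
    (hk : P'.elem k = (P.elem j).rev) (hlt : P'.elem j < P.elem j)
    (heq : ∀ i, i ≠ j → i ≠ k → P'.elem i = P.elem i) :
    schubertCell B F e P' ⊆ schubertVariety B F e P := by
  let t : Fin m → ℂ := Pi.single j 1 - Pi.single k 1
  have hBj (l : Fin m) : B (e (P'.elem j)) (e (P.elem l)) = if l = k then 1 else 0 := by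
    simp [he.apply_self, hj]
  have hBk (l : Fin m) : B (e (P'.elem k)) (e (P.elem l)) = if l = j then 1 else 0 := by
    simp [he.apply_self, hk]
  have hB (i l : Fin m) : t l * B (e (P'.elem i)) (e (P.elem l)) =
      if i = j ∧ l = k then -1 else if i = k ∧ l = j then 1 else 0 := by
    obtain rfl | hij := eq_or_ne i j
    · rw [hBj]
      obtain rfl | hl := eq_or_ne l k <;> simp [t, *]
    obtain rfl | hik := eq_or_ne i k
    · rw [hBk]
      obtain rfl | hl := eq_or_ne l j <;> simp [t, *]
    · rw [heq i hij hik, he.apply_self_elem]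
      simp [hij, hik]
  refine schubertCell_subset_schubertVariety_of_pencil hN he (t := t) (fun i hi => ?_)
    (fun i hi => ?_) (fun i l => ?_)
  · refine heq i ?_ ?_ <;> rintro rfl <;> simp [t, hjk, hjk.symm] at hi
  · obtain rfl | hij := eq_or_ne i j
    · exact hlt
    obtain rfl | hik := eq_or_ne i k
    · rwa [hk, Fin.rev_lt_iff, ← hj]
    · simp [t, hij, hik] at hi
  · rw [hB, hB]
    split_ifs <;> grind

lemma IsAdaptedBasis.apply_conic (he : IsAdaptedBasis B F e) {p μ : Fin N} (hp : p.rev ≠ p)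
    (hμ : μ.rev = μ) (s : ℂ) :
    B (e p.rev + s • e μ + (-(s ^ 2 / 2)) • e p) (e p.rev + s • e μ + (-(s ^ 2 / 2)) • e p) =
      0 := by
  have hμp : μ ≠ p := by
    rintro rfl
    exact hp hμ
  have hμp' : μ ≠ p.rev := fun h => hμp (by rw [← hμ, h, Fin.rev_rev])
  simp only [map_add, map_smul, LinearMap.add_apply, LinearMap.smul_apply, smul_eq_mul,
    he.apply_self, Fin.rev_rev, hμ, if_true, if_neg hp, if_neg hp.symm, if_neg hμp,
    if_neg hμp.symm, if_neg hμp', if_neg hμp'.symm]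
  ring

lemma schubertCell_subset_schubertVariety_of_update (hN : Odd N) (he : IsAdaptedBasis B F e)
    {j : Fin m} (heq : ∀ i, i ≠ j → P'.elem i = P.elem i) {c : ℂ → V}
    (hcc : ∀ s, B (c s) (c s) = 0) (hcP : ∀ s i, i ≠ j → B (c s) (e (P.elem i)) = 0)
    (hcont : ∀ φ : Dual ℂ V, Continuous fun s => φ (c s))
    (hc : ∀ s ≠ 0, HasLeadingIndex e (c s) (P.elem j)) (hc_zero : c 0 = e (P'.elem j)) :
    schubertCell B F e P' ⊆ schubertVariety B F e P := by
  refine schubertCell_subset_schubertVariety_of_curve hN he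
    (w := fun s => Function.update (e ∘ P.elem) j (c s)) (fun s i l => ?_) (fun φ i => ?_)
    (fun s hs i => ?_) (fun i => ?_)
  · simp only [Function.update_apply, Function.comp_apply]
    split_ifs with hi hl hl
    · exact hcc s
    · exact hcP s l hl
    · rw [he.isSymm.eq, hcP s i hi]
    · exact he.apply_self_elem P i l
  all_goals obtain rfl | hi := eq_or_ne i j
  · simpa only [Function.update_self] using hcont φ
  · simpa only [Function.update_of_ne hi] using continuous_const
  · simpa only [Function.update_self] using hc s hs
  · rw [Function.update_of_ne hi]
    exact hasLeadingIndex_self e _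
  · rw [Function.update_self, hc_zero]
  · rw [Function.update_of_ne hi, heq i hi, Function.comp_apply]

lemma schubertCell_subset_schubertVariety_of_single_rev (hN : Odd N) (he : IsAdaptedBasis B F e)
    {j : Fin m} (hlt : P'.elem j < P.elem j) (heq : ∀ i, i ≠ j → P'.elem i = P.elem i)
    (hrev : P'.elem j = (P.elem j).rev) :
    schubertCell B F e P' ⊆ schubertVariety B F e P := by
  obtain ⟨μ, hμ⟩ : ∃ μ : Fin N, μ.rev = μ := by
    obtain ⟨n, rfl⟩ := hN
    exact ⟨⟨n, by omega⟩, Fin.ext (by grind)⟩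
  have hμP : μ < P.elem j := by
    rw [hrev, Fin.lt_def, Fin.val_rev] at hlt
    rw [Fin.ext_iff, Fin.val_rev] at hμ
    rw [Fin.lt_def]
    omega
  refine schubertCell_subset_schubertVariety_of_update hN he heq
    (c := fun s => e (P'.elem j) + s • e μ + (-(s ^ 2 / 2)) • e (P.elem j))
    (fun s => ?_) (fun s i hi => ?_) (fun φ => ?_) (fun s hs => ?_) (by simp)
  · simp only [hrev]
    exact he.apply_conic (hrev ▸ hlt.ne) hμ s
  · have hμi : B (e μ) (e (P.elem i)) = 0 := by
      rw [he.apply_self, hμ, if_neg fun h => P.elem_ne_rev i i (by rw [h, hμ])]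
    have hP'i : B (e (P'.elem j)) (e (P.elem i)) = 0 := by
      rw [← heq i hi, he.apply_self_elem]
    simp [hμi, hP'i, he.apply_self_elem]
  · simp only [map_add, map_smul]
    fun_prop
  · refine hasLeadingIndex_add_smul_self (add_mem (e.self_mem_flag hlt)
      (Submodule.smul_mem _ _ (e.self_mem_flag hμP))) ?_
    simpa using hs

theorem schubertCell_subset_schubertVariety_of_isStep (hN : Odd N) (he : IsAdaptedBasis B F e)
    (h : IndexSet.IsStep P P') : schubertCell B F e P' ⊆ schubertVariety B F e P := by
  cases h with
  | single j hlt heq =>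
    by_cases hrev : P'.elem j = (P.elem j).rev
    · exact schubertCell_subset_schubertVariety_of_single_rev hN he hlt heq hrev
    · exact schubertCell_subset_schubertVariety_of_single hN he hlt heq hrev
  | double j k hjk hj hk hlt heq =>
    exact schubertCell_subset_schubertVariety_of_double hN he hjk hj hk hlt heq

variable {Q : IndexSet N m}

theorem schubertVariety_subset_of_le (hN : Odd N) (he : IsAdaptedBasis B F e) (hQP : Q ≤ P) :
    schubertVariety B F e Q ⊆ schubertVariety B F e P := by
  have hpath := IndexSet.reflTransGen_isStep hQP
  clear hQP
  induction hpath with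
  | refl => exact subset_rfl
  | tail _ hstep ih =>
    exact (closure_minimal (schubertCell_subset_schubertVariety_of_isStep hN he hstep)
      isClosed_closure).trans ih

theorem schubertVariety_eq_rankLocus (hN : Odd N) (he : IsAdaptedBasis B F e) (P : IndexSet N m) :
    schubertVariety B F e P = rankLocus B F P := by
  have := e.finiteDimensional_of_finite
  refine (closure_minimal (fun S hS => ?_) (isClosed_rankLocus F P)).antisymm fun S hS => ?_
  · rw [he.mem_rankLocus_iff, (mem_schubertCell_iff hN he).1 hS]
    exact fun _ => le_rfl
  · exact schubertVariety_subset_of_le hN he (he.mem_rankLocus_iff.1 hS)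
      (subset_closure ((mem_schubertCell_iff hN he).2 rfl))

theorem schubertVariety_subset_iff (hN : Odd N) (he : IsAdaptedBasis B F e) :
    schubertVariety B F e Q ⊆ schubertVariety B F e P ↔ Q ≤ P := by
  refine ⟨fun hQP => ?_, schubertVariety_subset_of_le hN he⟩
  have hS := spanPoint_mem_schubertCell hN he (fun j => hasLeadingIndex_self e (Q.elem j))
    (he.apply_self_elem Q)
  have hSP := hQP (subset_closure hS)
  rwa [schubertVariety_eq_rankLocus hN he, he.mem_rankLocus_iff,
    (mem_schubertCell_iff hN he).1 hS] at hSP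

end Degenerations

end OrthogonalGrassmannian

theorem mainTheorem12 {V : Type*} [AddCommGroup V] [Module ℂ V] (n m : ℕ)
    (hm : 2 * m < 2 * n + 1)
    (B : LinearMap.BilinForm ℂ V) (hsymm : B.IsSymm) (hnd : B.Nondegenerate)
    (F : Fin (2 * n + 1 + 1) → Submodule ℂ V) (hF : OrthogonalGrassmannian.IsIsotropicFlag B F)
    (e : Module.Basis (Fin (2 * n + 1)) ℂ V) (he : OrthogonalGrassmannian.IsAdaptedBasis B F e) :
    (∀ P : OrthogonalGrassmannian.IndexSet (2 * n + 1) m,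
      OrthogonalGrassmannian.schubertVariety B F e P = OrthogonalGrassmannian.rankLocus B F P) ∧
    (∀ P Q : OrthogonalGrassmannian.IndexSet (2 * n + 1) m,
      OrthogonalGrassmannian.schubertVariety B F e Q ⊆
        OrthogonalGrassmannian.schubertVariety B F e P ↔ Q ≤ P) :=
  ⟨OrthogonalGrassmannian.schubertVariety_eq_rankLocus ⟨n, rfl⟩ he,
    fun _ _ => OrthogonalGrassmannian.schubertVariety_subset_iff ⟨n, rfl⟩ he⟩
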